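/- Let $G$ be a group and $\pi\colon G\to\mathbf Z$ a homomorphism. Say that $\pi$ splits over a subgroup $U\le G$, with vertex group $B$ and stable letter $t$, if $t\in G$ and $B\le\ker\pi$ is a subgroup containing both $U$ and $tUt^{-1}$ such that the canonical homomorphism $$\operatorname{HNN}(B,\ \tau\colon U\xrightarrow{\ \sim\ }tUt^{-1})\longrightarrow G,\qquad \tau(u)=tut^{-1},$$ which is the inclusion on $B$ and sends the stable letter to $t$, is an isomorphism. **Theorem.** Let $G$ be a finitely generated group and $\pi\colon G\twoheadrightarrow\mathbf Z$ an epimorphism. Then at least one of the following holds: (i) $\pi$ splits over a finitely generated subgroup; (ii) $G$ is the direct limit of a sequence of epimorphisms $\varphi_n\colon G_n\twoheadrightarrow G_{n+1}$ $(n\in\mathbf N)$ of finitely generated groups, with limiting maps $\lambda_n\colon G_n\twoheadrightarrow G$, such that - for every $n$ the kernel of $\lambda_n$ is a free group of infinite rank; and - the epimorphisms $\pi\circ\lambda_n\colon G_n\twoheadrightarrow\mathbf Z$ split over a compatible sequence of finitely generated subgroups with compatible stable letters: there are subgroups $U_n\le B_n\le G_n$ with $U_n$ finitely generated and elements $t_n\in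 G_n$ such that $\pi\circ\lambda_n$ splits over $U_n$ with vertex group $B_n$ and stable letter $t_n$, and for every $n$ the map $\varphi_n$ is injective on $B_n$ and satisfies $\varphi_n(B_n)\subseteq B_{n+1}$, $\varphi_n(U_n)\subseteq U_{n+1}$ and $\varphi_n(t_n)=t_{n+1}$. -/

import Mathlib

universe u

namespace HNNSplitting

variable {G : Type u} [Group G]

/-- The conjugate subgroup `t U t⁻¹`. -/
def conjSubgroup (t : G) (U : Subgroup G) : Subgroup G :=
  U.map (MulAut.conj t).toMonoidHom

/-- For subgroups `U` and `t U t⁻¹` of `B`, the isomorphism `τ : U ≃ t U t⁻¹`, `u ↦ t u t⁻¹`,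
where both groups are regarded as subgroups of the group `B`. -/
noncomputable def conjEquiv (B U : Subgroup G) (t : G) (hU : U ≤ B) (hV : conjSubgroup t U ≤ B) :
    U.subgroupOf B ≃* (conjSubgroup t U).subgroupOf B :=
  (Subgroup.subgroupOfEquivOfLe hU).trans
    ((U.equivMapOfInjective (MulAut.conj t).toMonoidHom (MulAut.conj t).injective).trans
      (Subgroup.subgroupOfEquivOfLe hV).symm)

theorem coe_conjEquiv (B U : Subgroup G) (t : G) (hU : U ≤ B) (hV : conjSubgroup t U ≤ B)
    (a : U.subgroupOf B) :
    ((conjEquiv B U t hU hV a : B) : G) = t * ((a : B) : G) * t⁻¹ := rfl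

/-- The canonical homomorphism from `HNN(B, τ : U ≃ t U t⁻¹)` to `G`: it is the inclusion on the
vertex group `B` and sends the stable letter to `t`. -/
noncomputable def canonicalHom (B U : Subgroup G) (t : G) (hU : U ≤ B)
    (hV : conjSubgroup t U ≤ B) :
    HNNExtension B (U.subgroupOf B) ((conjSubgroup t U).subgroupOf B)
      (conjEquiv B U t hU hV) →* G :=
  HNNExtension.lift B.subtype t (fun a => by
    simp only [Subgroup.coe_subtype, coe_conjEquiv, inv_mul_cancel_right])

theorem canonicalHom_of (B U : Subgroup G) (t : G) (hU : U ≤ B) (hV : conjSubgroup t U ≤ B)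
    (b : B) : canonicalHom B U t hU hV (HNNExtension.of b) = b :=
  HNNExtension.lift_of _ _ _ b

theorem canonicalHom_t (B U : Subgroup G) (t : G) (hU : U ≤ B) (hV : conjSubgroup t U ≤ B) :
    canonicalHom B U t hU hV HNNExtension.t = t :=
  HNNExtension.lift_t _ _ _

/-- `π` splits as an HNN-extension with vertex group `B`, edge group `U` and stable letter `t`:
`B` is a subgroup of `ker π` containing `U` and `t U t⁻¹`, and the canonical homomorphism
`HNN(B, τ : U ≃ t U t⁻¹) → G` is an isomorphism. -/
structure IsSplitting (π : G →* Multiplicative ℤ) (B U : Subgroup G) (t : G) : Prop where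
  vertex_le_ker : B ≤ π.ker
  edge_le : U ≤ B
  conj_le : conjSubgroup t U ≤ B
  bijective : Function.Bijective (canonicalHom B U t edge_le conj_le)

/-- `π` splits over the subgroup `U`. -/
def SplitsOver (π : G →* Multiplicative ℤ) (U : Subgroup G) : Prop :=
  ∃ (B : Subgroup G) (t : G), IsSplitting π B U t

/-- The group is free on an infinite basis. -/
def IsFreeOfInfiniteRank (K : Type u) [Group K] : Prop :=
  ∃ X : Type u, Infinite X ∧ Nonempty (FreeGroupBasis X K)

end HNNSplitting

/-! Choose `t` with `π t` a generator of `ℤ` and a finitely generated `A ≤ ker π` with `G = ⟨A, t⟩`.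
Let `T_n` be generated by the `t ^ i A t ^ (-i)`, `i < n`. Then `T_n` and `t T_n t⁻¹` lie in
`T_(n+1)`, so `G_n = HNN(T_(n+1), T_n)` maps onto `G`.

The kernel of `G_n → G` meets the vertex group trivially, so it acts freely on the Bass–Serre tree
and is free. This is done algebraically: `kerToFreeGroup` embeds the kernel in the free group on the
edges `G ⧸ T_n` of the quotient graph, and Nielsen–Schreier applies.

In a later stage, every element becomes `t ^ (-k) b t ^ l` with `b` in the vertex group
(`hasStandardForm`). If it is trivial in `G`, applying `π` gives `k = l`, hence `b = 1`. So each
kernel is the union of the kernels of the transition maps, and the limit is `G`. A finitely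
generated kernel dies at a finite stage, which makes a later `G_m → G` an isomorphism and gives (i).
Otherwise all kernels have infinite rank, which gives (ii). -/

namespace HNNSplitting

variable {G : Type u} [Group G]

/-- The HNN-extension `HNN(B, τ : U ≃ t U t⁻¹)`. -/
abbrev ConjHNN (B U : Subgroup G) (t : G) (hU : U ≤ B) (hV : conjSubgroup t U ≤ B) : Type u :=
  HNNExtension B (U.subgroupOf B) ((conjSubgroup t U).subgroupOf B) (conjEquiv B U t hU hV)

theorem mem_conjSubgroup {t : G} {U : Subgroup G} {g : G} :
    g ∈ conjSubgroup t U ↔ t⁻¹ * g * t ∈ U := by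
  constructor
  · rintro ⟨u, hu, rfl⟩
    simpa [mul_assoc] using hu
  · intro h
    exact ⟨_, h, by simp [mul_assoc]⟩

/-! ### Freeness of the kernel -/

/-- `G` acts on `G × X` by right multiplication on the first factor. -/
def rightMulPerm (X : Type u) : G →* Equiv.Perm (G × X) where
  toFun g :=
    { toFun := fun p => (p.1 * g⁻¹, p.2)
      invFun := fun p => (p.1 * g, p.2)
      left_inv := fun p => by simp
      right_inv := fun p => by simp }
  map_one' := by ext p <;> simp
  map_mul' g h := by ext p <;> simp [mul_assoc]

/-- Right multiplication by `t⁻¹` on the first factor, recording the edge `g U` that is crossed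
in the second factor. -/
def edgePerm (U : Subgroup G) (t : G) : Equiv.Perm (G × FreeGroup (G ⧸ U)) where
  toFun p := (p.1 * t⁻¹, FreeGroup.of (p.1 : G ⧸ U) * p.2)
  invFun p := (p.1 * t, (FreeGroup.of ((p.1 * t : G) : G ⧸ U))⁻¹ * p.2)
  left_inv p := by simp
  right_inv p := by simp

theorem edgePerm_apply (U : Subgroup G) (t g : G) (x : FreeGroup (G ⧸ U)) :
    edgePerm U t (g, x) = (g * t⁻¹, FreeGroup.of (g : G ⧸ U) * x) := rfl

theorem edgePerm_inv_apply (U : Subgroup G) (t g : G) (x : FreeGroup (G ⧸ U)) :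
    (edgePerm U t)⁻¹ (g, x) = (g * t, (FreeGroup.of ((g * t : G) : G ⧸ U))⁻¹ * x) := rfl

theorem rightMulPerm_apply (X : Type u) (b g : G) (x : X) :
    rightMulPerm X b (g, x) = (g * b⁻¹, x) := rfl

section FreeKernel

variable {B U : Subgroup G} {t : G} (hU : U ≤ B) (hV : conjSubgroup t U ≤ B)

/-- The action of the HNN-extension on `G × FreeGroup (G ⧸ U)`, which records in the second factor
the edges of the quotient of the Bass–Serre tree by the kernel of `canonicalHom` that are
crossed. -/
noncomputable def pathAction :
    ConjHNN B U t hU hV →* Equiv.Perm (G × FreeGroup (G ⧸ U)) :=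
  HNNExtension.lift ((rightMulPerm _).comp B.subtype) (edgePerm U t) (fun a => by
    ext ⟨g, x⟩ : 1
    simp only [MonoidHom.comp_apply, Equiv.Perm.mul_apply, rightMulPerm_apply, edgePerm_apply,
      Subgroup.coe_subtype, coe_conjEquiv]
    -- The HNN relation is respected because moving by an element of `U` does not change the edge `g
    -- U`.
    have h : ((g * ((a : B) : G)⁻¹ : G) : G ⧸ U) = g := by
      rw [QuotientGroup.eq]
      simpa using Subgroup.mem_subgroupOf.1 a.2
    rw [h]
    simp [mul_assoc])

theorem pathAction_of (b : B) : pathAction hU hV (HNNExtension.of b) = rightMulPerm _ (b : G) :=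
  HNNExtension.lift_of _ _ _ b

theorem pathAction_t : pathAction hU hV HNNExtension.t = edgePerm U t :=
  HNNExtension.lift_t _ _ _

/-- A kernel element fixes the first coordinate and multiplies the second on the left by a factor
depending only on the first; this makes `kerToFreeGroup` multiplicative. -/
theorem exists_pathAction_eq (w : ConjHNN B U t hU hV) :
    ∃ f : G → FreeGroup (G ⧸ U), ∀ g x,
      pathAction hU hV w (g, x) = (g * (canonicalHom B U t hU hV w)⁻¹, f g * x) := by
  induction w using HNNExtension.induction_on with
  | of b => exact ⟨fun _ => 1, fun g x => by
      rw [pathAction_of, rightMulPerm_apply, canonicalHom_of, one_mul]⟩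
  | t => exact ⟨fun g => FreeGroup.of (g : G ⧸ U), fun g x => by
      rw [pathAction_t, edgePerm_apply, canonicalHom_t]⟩
  | mul v w hv hw =>
    obtain ⟨f, hf⟩ := hv
    obtain ⟨k, hk⟩ := hw
    exact ⟨fun g => f (g * (canonicalHom B U t hU hV w)⁻¹) * k g, fun g x => by
      rw [map_mul, map_mul, Equiv.Perm.mul_apply, hk, hf, mul_inv_rev, mul_assoc, mul_assoc]⟩
  | inv w hw =>
    obtain ⟨f, hf⟩ := hw
    exact ⟨fun g => (f (g * canonicalHom B U t hU hV w))⁻¹, fun g x => by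
      rw [map_inv, map_inv, Equiv.Perm.inv_eq_iff_eq, hf]
      simp⟩

/-- The kernel of `canonicalHom` maps to the free group on the edges of the quotient graph. -/
noncomputable def kerToFreeGroup :
    (canonicalHom B U t hU hV).ker →* FreeGroup (G ⧸ U) :=
  MonoidHom.mk' (fun k => (pathAction hU hV k (1, 1)).2) (fun v w => by
    obtain ⟨f, hf⟩ := exists_pathAction_eq hU hV (v : ConjHNN B U t hU hV)
    obtain ⟨k, hk⟩ := exists_pathAction_eq hU hV (w : ConjHNN B U t hU hV)
    have h : canonicalHom B U t hU hV w = 1 := w.2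
    rw [Subgroup.coe_mul, map_mul, Equiv.Perm.mul_apply, hk, hf, hf, h]
    simp)

/-- A reduced word in the HNN-extension crosses a reduced sequence of edges. -/
theorem exists_isReduced_pathAction (l : List (ℤˣ × B))
    (hl : l.IsChain fun a b => a.2 ∈ HNNExtension.toSubgroup (U.subgroupOf B)
      ((conjSubgroup t U).subgroupOf B) a.1 → a.1 = b.1) :
    ∃ (g : G) (L : List ((G ⧸ U) × Bool)), FreeGroup.IsReduced L ∧
      pathAction hU hV (l.map fun x => HNNExtension.t ^ (x.1 : ℤ) * HNNExtension.of x.2).prod (1, 1)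
        = (g, FreeGroup.mk L) ∧
      L.head? = l.head?.map
        (fun a => (((if a.1 = 1 then g * t else g : G) : G ⧸ U), decide (a.1 = 1))) := by
  -- The formula for the first letter of `L` drives the induction: when `g` is the current position,
  -- the last edge crossed is `g t U` after `t` and `g U` after `t⁻¹`.
  induction l with
  | nil => exact ⟨1, [], FreeGroup.IsReduced.nil, by simp [FreeGroup.one_eq_mk], rfl⟩
  | cons a l ih =>
    obtain ⟨hal, hl⟩ := List.isChain_cons.1 hl
    obtain ⟨g, L, hL, hg, hhead⟩ := ih hl
    obtain ⟨s, b⟩ := a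
    simp only [List.map_cons, List.prod_cons, map_mul, Equiv.Perm.mul_apply, hg, pathAction_of,
      rightMulPerm_apply]
    rcases Int.units_eq_one_or s with rfl | rfl
    · refine ⟨g * (b : G)⁻¹ * t⁻¹, (((g * (b : G)⁻¹ : G) : G ⧸ U), true) :: L,
        List.isChain_cons.2 ⟨?_, hL⟩, ?_, by simp⟩
      · intro y hy
        rw [hhead, Option.mem_def, Option.map_eq_some_iff] at hy
        obtain ⟨⟨s', b'⟩, hmem, rfl⟩ := hy
        have := hal _ hmem
        rcases Int.units_eq_one_or s' with rfl | rfl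
        · simp
        -- A backtrack `t b t⁻¹` crosses the same edge twice only if `b ∈ U`, which the chain
        -- condition excludes.
        · intro h
          exfalso
          have h2 : b ∈ U.subgroupOf B := by
            rw [Subgroup.mem_subgroupOf]
            have := QuotientGroup.eq.1 h
            simpa using this
          have h3 : (1 : ℤˣ) = -1 := this h2
          exact absurd h3 (by decide)
      · simp only [Units.val_one, zpow_one, pathAction_t, edgePerm_apply]
        rfl
    · refine ⟨g * (b : G)⁻¹ * t, (((g * (b : G)⁻¹ * t : G) : G ⧸ U), false) :: L,
        List.isChain_cons.2 ⟨?_, hL⟩, ?_, by simp⟩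
      · intro y hy
        rw [hhead, Option.mem_def, Option.map_eq_some_iff] at hy
        obtain ⟨⟨s', b'⟩, hmem, rfl⟩ := hy
        have := hal _ hmem
        rcases Int.units_eq_one_or s' with rfl | rfl
        -- Likewise, a backtrack `t⁻¹ b t` needs `b ∈ t U t⁻¹`.
        · intro h
          exfalso
          have h2 : b ∈ (conjSubgroup t U).subgroupOf B := by
            rw [Subgroup.mem_subgroupOf, mem_conjSubgroup]
            have := QuotientGroup.eq.1 h
            simpa [mul_assoc] using this
          have h3 : (-1 : ℤˣ) = 1 := this h2
          exact absurd h3 (by decide)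
        · simp
      · simp only [Units.val_neg, Units.val_one, zpow_neg, zpow_one, map_inv, pathAction_t,
          edgePerm_inv_apply]
        rfl

/-- The edge word of a normal form is reduced, so it is trivial only if no stable letter occurs. The
element then lies in `B`, which embeds in `G`. -/
theorem kerToFreeGroup_injective : Function.Injective (kerToFreeGroup hU hV) := by
  classical
  rw [injective_iff_map_eq_one]
  rintro ⟨k, hk⟩ h
  obtain ⟨d⟩ := HNNExtension.NormalWord.TransversalPair.nonempty B (U.subgroupOf B)
    ((conjSubgroup t U).subgroupOf B)
  let w : HNNExtension.NormalWord d := k • HNNExtension.NormalWord.empty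
  have hw : w.prod (conjEquiv B U t hU hV) = k := by
    rw [HNNExtension.NormalWord.prod_smul, HNNExtension.NormalWord.prod_empty, mul_one]
  obtain ⟨g, L, hL, hg, hhead⟩ := exists_isReduced_pathAction hU hV w.toList w.chain
  have h1 : (pathAction hU hV k (1, 1)).2 = 1 := h
  rw [← hw, HNNExtension.NormalWord.ReducedWord.prod, map_mul, Equiv.Perm.mul_apply, hg,
    pathAction_of, rightMulPerm_apply] at h1
  have h2 : L = [] := by
    rw [← hL.reduce_eq, ← FreeGroup.toWord_mk, FreeGroup.toWord_eq_nil_iff]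
    exact h1
  have h3 : w.toList = [] := by
    rw [h2] at hhead
    cases hl : w.toList with
    | nil => rfl
    | cons a l => rw [hl] at hhead; simp at hhead
  have h4 : k = HNNExtension.of w.head := by
    rw [← hw, HNNExtension.NormalWord.ReducedWord.prod, h3]
    simp
  have h5 : w.head = 1 := by
    have : canonicalHom B U t hU hV k = 1 := hk
    rw [h4, canonicalHom_of] at this
    exact_mod_cast this
  exact Subtype.ext (h4.trans (by rw [h5, map_one]; rfl))

theorem isFreeGroup_ker_canonicalHom : IsFreeGroup (canonicalHom B U t hU hV).ker :=
  IsFreeGroup.ofMulEquiv (MonoidHom.ofInjective (kerToFreeGroup_injective hU hV)).symm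

end FreeKernel

/-! ### An HNN-extension splits over its own edge group -/

/-- Inside the HNN-extension itself, the image of `B` and the stable letter give a splitting. -/
theorem canonicalHom_range_bijective {B U : Subgroup G} {t : G} (hU : U ≤ B)
    (hV : conjSubgroup t U ≤ B)
    (hU' : ((U.subgroupOf B).map (HNNExtension.of (φ := conjEquiv B U t hU hV))) ≤
      (HNNExtension.of (φ := conjEquiv B U t hU hV)).range)
    (hV' : conjSubgroup HNNExtension.t
      ((U.subgroupOf B).map (HNNExtension.of (φ := conjEquiv B U t hU hV))) ≤
      (HNNExtension.of (φ := conjEquiv B U t hU hV)).range) :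
    Function.Bijective (canonicalHom _ _ HNNExtension.t hU' hV') := by
  let j := HNNExtension.of (φ := conjEquiv B U t hU hV)
  let f : ConjHNN B U t hU hV →* ConjHNN _ _ HNNExtension.t hU' hV' :=
    HNNExtension.lift (HNNExtension.of.comp j.rangeRestrict) HNNExtension.t (fun a => by
      have ha : j.rangeRestrict (a : B) ∈ ((U.subgroupOf B).map j).subgroupOf j.range :=
        Subgroup.mem_subgroupOf.2 ⟨a, a.2, rfl⟩
      have key := HNNExtension.t_mul_of (φ := conjEquiv _ _ HNNExtension.t hU' hV') ⟨_, ha⟩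
      refine key.trans ?_
      refine congrArg (fun b => HNNExtension.of b * HNNExtension.t) (Subtype.ext ?_)
      rw [coe_conjEquiv]
      exact (HNNExtension.equiv_eq_conj a).symm)
  have hf_of : ∀ b, f (HNNExtension.of b) = HNNExtension.of (j.rangeRestrict b) :=
    fun b => HNNExtension.lift_of _ _ _ b
  have hf_t : f HNNExtension.t = HNNExtension.t := HNNExtension.lift_t _ _ _
  have h1 : f.comp (canonicalHom _ _ HNNExtension.t hU' hV') = MonoidHom.id _ := by
    apply HNNExtension.hom_ext
    · ext ⟨_, b, rfl⟩
      simp only [MonoidHom.comp_apply, canonicalHom_of, hf_of, MonoidHom.id_apply]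
      rfl
    · simp only [MonoidHom.comp_apply, canonicalHom_t, hf_t, MonoidHom.id_apply]
  have h2 : (canonicalHom _ _ HNNExtension.t hU' hV').comp f = MonoidHom.id _ := by
    apply HNNExtension.hom_ext
    · ext b
      simp only [MonoidHom.comp_apply, hf_of, canonicalHom_of, MonoidHom.id_apply]
      rfl
    · simp only [MonoidHom.comp_apply, canonicalHom_t, hf_t, MonoidHom.id_apply]
  exact Function.bijective_iff_has_inverse.2 ⟨f, DFunLike.congr_fun h1, DFunLike.congr_fun h2⟩

theorem fg_map {H : Type*} [Group H] {K : Subgroup G} (hK : K.FG) (f : G →* H) : (K.map f).FG := by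
  classical
  obtain ⟨S, rfl⟩ := hK
  exact ⟨S.image f, by rw [Finset.coe_image, MonoidHom.map_closure]⟩

theorem conjSubgroup_mono (t : G) {U V : Subgroup G} (h : U ≤ V) :
    conjSubgroup t U ≤ conjSubgroup t V := Subgroup.map_mono h

/-! ### The tower of subgroups and its HNN-extensions -/

/-- The subgroup generated by `t ^ i A t ^ (-i)` for `i < n`. -/
def tower (A : Subgroup G) (t : G) : ℕ → Subgroup G
  | 0 => ⊥
  | n + 1 => A ⊔ conjSubgroup t (tower A t n)

section Tower

variable (A : Subgroup G) (t : G)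

theorem le_tower_succ (n : ℕ) : A ≤ tower A t (n + 1) := le_sup_left

theorem conj_tower_le (n : ℕ) : conjSubgroup t (tower A t n) ≤ tower A t (n + 1) := le_sup_right

theorem tower_le_succ (n : ℕ) : tower A t n ≤ tower A t (n + 1) := by
  induction n with
  | zero => exact bot_le
  | succ n ih => exact sup_le_sup_left (conjSubgroup_mono t ih) A

theorem tower_mono : Monotone (tower A t) := monotone_nat_of_le_succ (tower_le_succ A t)

theorem fg_tower (hA : A.FG) (n : ℕ) : (tower A t n).FG := by
  induction n with
  | zero => exact Subgroup.FG.bot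
  | succ n ih => exact hA.sup (fg_map ih _)

theorem tower_le_ker {H : Type*} [Group H] (π : G →* H) (hA : A ≤ π.ker) (n : ℕ) :
    tower A t n ≤ π.ker := by
  induction n with
  | zero => exact bot_le
  | succ n ih =>
    refine sup_le hA ?_
    rintro _ ⟨u, hu, rfl⟩
    exact (MonoidHom.normal_ker π).conj_mem u (ih hu) t

/-- The HNN-extension with vertex group `tower A t (n + 1)` and edge group `tower A t n`. -/
abbrev Stage (n : ℕ) : Type u :=
  ConjHNN (tower A t (n + 1)) (tower A t n) t (tower_le_succ A t n) (conj_tower_le A t n)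

/-- The inclusion of the vertex group. -/
noncomputable def vertexHom (n : ℕ) : tower A t (n + 1) →* Stage A t n := HNNExtension.of

/-- The stable letter. -/
noncomputable def stableLetter (n : ℕ) : Stage A t n := HNNExtension.t

/-- The canonical homomorphism to `G`. -/
noncomputable def stageHom (n : ℕ) : Stage A t n →* G := canonicalHom _ _ _ _ _

variable {A t}

theorem stageHom_vertexHom {n : ℕ} (b : tower A t (n + 1)) :
    stageHom A t n (vertexHom A t n b) = b := canonicalHom_of _ _ _ _ _ b

theorem stageHom_stableLetter {n : ℕ} : stageHom A t n (stableLetter A t n) = t :=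
  canonicalHom_t _ _ _ _ _

theorem vertexHom_conj {n : ℕ} {u v : tower A t (n + 1)} (hu : (u : G) ∈ tower A t n)
    (hv : (v : G) = t * u * t⁻¹) :
    stableLetter A t n * vertexHom A t n u = vertexHom A t n v * stableLetter A t n := by
  refine (HNNExtension.t_mul_of (φ := conjEquiv _ _ t (tower_le_succ A t n) (conj_tower_le A t n))
    ⟨u, Subgroup.mem_subgroupOf.2 hu⟩).trans ?_
  refine congrArg (fun b => HNNExtension.of b * HNNExtension.t) (Subtype.ext ?_)
  rw [coe_conjEquiv, hv]

theorem vertexHom_conj_inv {n : ℕ} {u v : tower A t (n + 1)} (hu : (u : G) ∈ tower A t n)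
    (hv : (v : G) = t * u * t⁻¹) :
    vertexHom A t n v = stableLetter A t n * vertexHom A t n u * (stableLetter A t n)⁻¹ := by
  rw [vertexHom_conj hu hv, mul_inv_cancel_right]

/-- The transition maps. -/
noncomputable def transition (m n : ℕ) (h : m ≤ n) : Stage A t m →* Stage A t n :=
  HNNExtension.lift
    ((vertexHom A t n).comp (Subgroup.inclusion (tower_mono A t (Nat.succ_le_succ h))))
    (stableLetter A t n)
    (fun a => vertexHom_conj (tower_mono A t h (Subgroup.mem_subgroupOf.1 a.2))
      (coe_conjEquiv _ _ _ (tower_le_succ A t m) (conj_tower_le A t m) a))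

theorem transition_vertexHom {m n : ℕ} (h : m ≤ n) (b : tower A t (m + 1)) :
    transition m n h (vertexHom A t m b) =
      vertexHom A t n ⟨b, tower_mono A t (Nat.succ_le_succ h) b.2⟩ :=
  HNNExtension.lift_of _ _ _ b

theorem transition_stableLetter {m n : ℕ} (h : m ≤ n) :
    transition m n h (stableLetter A t m) = stableLetter A t n :=
  HNNExtension.lift_t _ _ _

theorem stage_hom_ext {M : Type*} [Monoid M] {n : ℕ} {f g : Stage A t n →* M}
    (h : ∀ b, f (vertexHom A t n b) = g (vertexHom A t n b))
    (ht : f (stableLetter A t n) = g (stableLetter A t n)) : f = g :=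
  HNNExtension.hom_ext (MonoidHom.ext h) ht

theorem transition_self (n : ℕ) : transition n n le_rfl = MonoidHom.id (Stage A t n) :=
  stage_hom_ext (fun b => transition_vertexHom le_rfl b) (transition_stableLetter le_rfl)

theorem transition_comp {i j k : ℕ} (hij : i ≤ j) (hjk : j ≤ k) :
    (transition j k hjk).comp (transition i j hij) =
      (transition i k (hij.trans hjk) : Stage A t i →* Stage A t k) :=
  stage_hom_ext (fun b => by simp only [MonoidHom.comp_apply, transition_vertexHom])
    (by simp only [MonoidHom.comp_apply, transition_stableLetter])

theorem stageHom_comp_transition {m n : ℕ} (h : m ≤ n) :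
    (stageHom A t n).comp (transition m n h) = stageHom A t m :=
  stage_hom_ext
    (fun b => by simp only [MonoidHom.comp_apply, transition_vertexHom, stageHom_vertexHom])
    (by simp only [MonoidHom.comp_apply, transition_stableLetter, stageHom_stableLetter])

theorem stageHom_transition {m n : ℕ} (h : m ≤ n) (x : Stage A t m) :
    stageHom A t n (transition m n h x) = stageHom A t m x :=
  DFunLike.congr_fun (stageHom_comp_transition h) x

instance directedSystem_transition :
    DirectedSystem (Stage A t) (fun i j h => transition (A := A) (t := t) i j h) where
  map_self i x := DFunLike.congr_fun (transition_self i) x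
  map_map _ _ _ hij hjk x := DFunLike.congr_fun (transition_comp hij hjk) x

/-- The stable letter conjugates the image of `tower A t k` as long as `k ≤ n`, so `A` and the
stable letter recover the vertex group level by level. -/
theorem vertexHom_mem_of_le {n : ℕ} {R : Subgroup (Stage A t n)} (ht : stableLetter A t n ∈ R)
    (hA : (A.subgroupOf (tower A t (n + 1))).map (vertexHom A t n) ≤ R) :
    ∀ k, k ≤ n + 1 → ∀ b : tower A t (n + 1), (b : G) ∈ tower A t k → vertexHom A t n b ∈ R := by
  intro k
  induction k with
  | zero =>
    intro _ b hb
    have : b = 1 := Subtype.ext (Subgroup.mem_bot.1 hb)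
    rw [this, map_one]
    exact R.one_mem
  | succ k ih =>
    intro hk b hb
    have hle : tower A t (k + 1) ≤ (R.comap (vertexHom A t n)).map (Subgroup.subtype _) := by
      refine sup_le (fun a ha => ?_) ?_
      · exact ⟨⟨a, le_tower_succ A t n ha⟩, hA ⟨_, ha, rfl⟩, rfl⟩
      · rintro _ ⟨u, hu, rfl⟩
        have hu' : u ∈ tower A t n := tower_mono A t (Nat.le_of_succ_le_succ hk) hu
        refine ⟨⟨t * u * t⁻¹, conj_tower_le A t n ⟨u, hu', rfl⟩⟩, ?_, rfl⟩
        have := vertexHom_conj_inv (A := A) (t := t) (n := n)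
          (u := ⟨u, tower_le_succ A t n hu'⟩)
          (v := ⟨t * u * t⁻¹, conj_tower_le A t n ⟨u, hu', rfl⟩⟩) hu' rfl
        rw [SetLike.mem_coe, Subgroup.mem_comap, this]
        exact R.mul_mem (R.mul_mem ht (ih (Nat.le_of_succ_le hk) _ hu)) (R.inv_mem ht)
    obtain ⟨c, hc, hcb⟩ := hle hb
    rwa [show b = c from Subtype.ext hcb.symm]

theorem stage_subgroup_eq_top {n : ℕ} {R : Subgroup (Stage A t n)} (ht : stableLetter A t n ∈ R)
    (hA : (A.subgroupOf (tower A t (n + 1))).map (vertexHom A t n) ≤ R) : R = ⊤ := by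
  refine eq_top_iff.2 fun x _ => ?_
  induction x using HNNExtension.induction_on with
  | of b => exact vertexHom_mem_of_le ht hA (n + 1) le_rfl b b.2
  | t => exact ht
  | mul x y hx hy => exact R.mul_mem (hx trivial) (hy trivial)
  | inv x hx => exact R.inv_mem (hx trivial)

theorem transition_surjective {m n : ℕ} (h : m ≤ n) :
    Function.Surjective (transition m n h : Stage A t m →* Stage A t n) := by
  refine MonoidHom.range_eq_top.1 (stage_subgroup_eq_top ⟨_, transition_stableLetter h⟩ ?_)
  rintro _ ⟨b, hb, rfl⟩
  exact ⟨vertexHom A t m ⟨b, le_tower_succ A t m hb⟩, transition_vertexHom h _⟩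

theorem fg_subgroupOf {K L : Subgroup G} (hK : K.FG) (h : K ≤ L) : (K.subgroupOf L).FG := by
  have : Group.FG K := (Group.fg_iff_subgroup_fg K).2 hK
  exact (Group.fg_iff_subgroup_fg _).1
    (Group.fg_of_surjective (f := (Subgroup.subgroupOfEquivOfLe h).symm.toMonoidHom)
      (Subgroup.subgroupOfEquivOfLe h).symm.surjective)

theorem fg_stage (hA : A.FG) (n : ℕ) : Group.FG (Stage A t n) := by
  rw [Group.fg_def]
  have h : Subgroup.zpowers (stableLetter A t n) ⊔
      (A.subgroupOf (tower A t (n + 1))).map (vertexHom A t n) = ⊤ :=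
    stage_subgroup_eq_top (Subgroup.mem_sup_left (Subgroup.mem_zpowers _)) le_sup_right
  rw [← h]
  refine Subgroup.FG.sup ?_ (fg_map (fg_subgroupOf hA (le_tower_succ A t n)) _)
  exact ⟨{stableLetter A t n}, by simp [Subgroup.zpowers_eq_closure]⟩

theorem stageHom_surjective (h : A ⊔ Subgroup.zpowers t = ⊤) (n : ℕ) :
    Function.Surjective (stageHom A t n) := by
  rw [← MonoidHom.range_eq_top, eq_top_iff, ← h, sup_le_iff, Subgroup.zpowers_le]
  exact ⟨fun a ha => ⟨vertexHom A t n ⟨a, le_tower_succ A t n ha⟩, stageHom_vertexHom _⟩,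
    _, stageHom_stableLetter⟩

/-! ### Standard forms and the kernels in the limit -/

/-- Each stable letter moved past `b` raises its tower level by one and requires it to lie in the
edge group `tower A t m`; `n + l ≤ m` leaves room for `l` moves. -/
theorem exists_stableLetter_pow_mul_vertexHom {n m : ℕ} (b : tower A t (m + 1))
    (hb : (b : G) ∈ tower A t (n + 1)) (l : ℕ) (h : n + l ≤ m) :
    ∃ c : tower A t (m + 1), (c : G) ∈ tower A t (n + l + 1) ∧
      stableLetter A t m ^ l * vertexHom A t m b = vertexHom A t m c * stableLetter A t m ^ l := by
  induction l with
  | zero => exact ⟨b, hb, by simp⟩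
  | succ l ih =>
    obtain ⟨c, hc, hbc⟩ := ih (by omega)
    have hd : t * c * t⁻¹ ∈ tower A t (n + (l + 1) + 1) := conj_tower_le A t _ ⟨c, hc, rfl⟩
    refine ⟨⟨_, tower_mono A t (by omega) hd⟩, hd, ?_⟩
    rw [pow_succ', mul_assoc, hbc, ← mul_assoc,
      vertexHom_conj (tower_mono A t (by omega) hc) (v := ⟨_, tower_mono A t (by omega) hd⟩) rfl,
      mul_assoc]

/-- After passing to a later stage, `w` has the form `t ^ (-k) * b * t ^ l` with `b` in the vertex
group. -/
def HasStandardForm {n : ℕ} (w : Stage A t n) : Prop :=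
  ∃ (m : ℕ) (h : n ≤ m) (k l : ℕ) (b : tower A t (m + 1)),
    transition n m h w = (stableLetter A t m ^ k)⁻¹ * vertexHom A t m b * stableLetter A t m ^ l

theorem transition_standardForm {n m m' : ℕ} {h : n ≤ m} {w : Stage A t n} {k l : ℕ}
    {b : tower A t (m + 1)} (hm : m ≤ m')
    (hw : transition n m h w =
      (stableLetter A t m ^ k)⁻¹ * vertexHom A t m b * stableLetter A t m ^ l) :
    transition n m' (h.trans hm) w = (stableLetter A t m' ^ k)⁻¹ *
      vertexHom A t m' ⟨b, tower_mono A t (Nat.succ_le_succ hm) b.2⟩ * stableLetter A t m' ^ l := by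
  rw [← transition_comp h hm, MonoidHom.comp_apply, hw]
  simp only [map_mul, map_inv, map_pow, transition_stableLetter, transition_vertexHom]

theorem HasStandardForm.mul_vertexHom {n : ℕ} {w : Stage A t n} (hw : HasStandardForm w)
    (b : tower A t (n + 1)) : HasStandardForm (w * vertexHom A t n b) := by
  obtain ⟨m, h, k, l, c, hw⟩ := hw
  have hb : (b : G) ∈ tower A t (m + l + 1) := tower_mono A t (by omega) b.2
  obtain ⟨d, -, hd⟩ := exists_stableLetter_pow_mul_vertexHom (A := A) (t := t) (n := n)
    (m := m + l) ⟨b, hb⟩ b.2 l (by omega)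
  refine ⟨m + l, by omega, k, l, ⟨c, tower_mono A t (by omega) c.2⟩ * d, ?_⟩
  rw [map_mul, transition_standardForm (Nat.le_add_right m l) hw, transition_vertexHom, mul_assoc,
    hd, map_mul]
  simp only [mul_assoc]

theorem HasStandardForm.mul_stableLetter {n : ℕ} {w : Stage A t n} (hw : HasStandardForm w) :
    HasStandardForm (w * stableLetter A t n) := by
  obtain ⟨m, h, k, l, c, hw⟩ := hw
  exact ⟨m, h, k, l + 1, c, by rw [map_mul, hw, transition_stableLetter, pow_succ, mul_assoc]⟩

theorem HasStandardForm.mul_stableLetter_inv {n : ℕ} {w : Stage A t n} (hw : HasStandardForm w) :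
    HasStandardForm (w * (stableLetter A t n)⁻¹) := by
  obtain ⟨m, h, k, l, c, hw⟩ := hw
  cases l with
  | succ l =>
    exact ⟨m, h, k, l, c, by
      rw [map_mul, hw, map_inv, transition_stableLetter, pow_succ, ← mul_assoc,
        mul_inv_cancel_right]⟩
  | zero =>
    -- Here `c t⁻¹ = t⁻¹ (t c t⁻¹)`, valid one stage later, where `c` lies in the edge group.
    have hd : t * c * t⁻¹ ∈ tower A t (m + 1 + 1) := conj_tower_le A t _ ⟨c, c.2, rfl⟩
    refine ⟨m + 1, by omega, k + 1, 0, ⟨_, hd⟩, ?_⟩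
    have hc : (c : G) ∈ tower A t (m + 1 + 1) := tower_le_succ A t _ c.2
    have hconj : vertexHom A t (m + 1) ⟨_, hd⟩ = _ :=
      vertexHom_conj_inv (u := ⟨(c : G), hc⟩) c.2 rfl
    rw [map_mul, transition_standardForm (Nat.le_add_right m 1) hw, map_inv,
      transition_stableLetter, hconj, pow_succ']
    simp [mul_assoc]

theorem hasStandardForm {n : ℕ} (w : Stage A t n) : HasStandardForm w := by
  -- Treating `w` and `w⁻¹` together lets the induction pass through inverses.
  have key : ∀ v : Stage A t n, HasStandardForm v →
      HasStandardForm (v * w) ∧ HasStandardForm (v * w⁻¹) := by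
    induction w using HNNExtension.induction_on with
    | of b =>
      exact fun v hv => ⟨hv.mul_vertexHom b, by
        have := hv.mul_vertexHom b⁻¹
        rwa [map_inv] at this⟩
    | t => exact fun v hv => ⟨hv.mul_stableLetter, hv.mul_stableLetter_inv⟩
    | mul x y hx hy =>
      refine fun v hv => ⟨?_, ?_⟩
      · rw [← mul_assoc]
        exact (hy _ (hx v hv).1).1
      · rw [mul_inv_rev, ← mul_assoc]
        exact (hx _ (hy v hv).2).2
    | inv x hx => exact fun v hv => ⟨(hx v hv).2, by rw [inv_inv]; exact (hx v hv).1⟩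
  have h1 : HasStandardForm (1 : Stage A t n) := ⟨n, le_rfl, 0, 0, 1, by simp⟩
  simpa using (key 1 h1).1

/-- The kernel of `stageHom` is the union of the kernels of the transition maps. -/
theorem exists_transition_eq_one {π : G →* Multiplicative ℤ} (hA : A ≤ π.ker)
    (ht : π t = Multiplicative.ofAdd 1) {n : ℕ} {w : Stage A t n} (hw : stageHom A t n w = 1) :
    ∃ (m : ℕ) (h : n ≤ m), transition n m h w = 1 := by
  obtain ⟨m, h, k, l, b, hb⟩ := hasStandardForm w
  refine ⟨m, h, ?_⟩
  have h1 : (t ^ k)⁻¹ * b * t ^ l = 1 := by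
    rw [← hw, ← stageHom_transition h, hb]
    simp only [map_mul, map_inv, map_pow, stageHom_vertexHom, stageHom_stableLetter]
  have hbk : π b = 1 := tower_le_ker A t π hA _ b.2
  have hkl : k = l := by
    have := congrArg (fun g => (π g).toAdd) h1
    simp only [map_mul, map_inv, map_pow, hbk, ht] at this
    simp at this
    omega
  subst hkl
  have hb1 : b = 1 := by
    refine Subtype.ext ?_
    rw [mul_assoc, inv_mul_eq_one] at h1
    simpa using h1.symm
  rw [hb, hb1, map_one, mul_one, inv_mul_cancel]

/-- If the kernel of `stageHom` is finitely generated, then a later `stageHom` is injective. -/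
theorem exists_stageHom_injective {π : G →* Multiplicative ℤ} (hA : A ≤ π.ker)
    (ht : π t = Multiplicative.ofAdd 1) {n : ℕ} (hfg : (stageHom A t n).ker.FG) :
    ∃ m, Function.Injective (stageHom A t m) := by
  obtain ⟨S, hS⟩ := hfg
  have hex : ∀ s ∈ S, ∃ (m : ℕ) (h : n ≤ m), transition n m h s = 1 := fun s hs =>
    exists_transition_eq_one hA ht (by
      have : s ∈ (stageHom A t n).ker := hS ▸ Subgroup.subset_closure hs
      exact this)
  choose! M hM hM1 using hex
  have hn : n ≤ n + S.sup M := Nat.le_add_right _ _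
  refine ⟨n + S.sup M, (injective_iff_map_eq_one _).2 fun x hx => ?_⟩
  -- A kernel element of the later stage lifts to the kernel at stage `n`, all of whose generators
  -- have died by then.
  obtain ⟨w, rfl⟩ := transition_surjective hn x
  rw [stageHom_transition] at hx
  have hle : (stageHom A t n).ker ≤ (transition n _ hn).ker := by
    rw [← hS, Subgroup.closure_le]
    intro s hs
    have hs' : M s ≤ n + S.sup M := (Finset.le_sup (f := M) hs).trans (Nat.le_add_left _ _)
    rw [SetLike.mem_coe, MonoidHom.mem_ker, ← transition_comp (hM s hs) hs', MonoidHom.comp_apply,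
      hM1 s hs, map_one]
  exact hle hx

theorem isFreeOfInfiniteRank_ker_stageHom {π : G →* Multiplicative ℤ} (hA : A ≤ π.ker)
    (ht : π t = Multiplicative.ofAdd 1) (hinj : ∀ m, ¬ Function.Injective (stageHom A t m))
    (n : ℕ) : IsFreeOfInfiniteRank (stageHom A t n).ker := by
  have : IsFreeGroup (stageHom A t n).ker := isFreeGroup_ker_canonicalHom _ _
  refine ⟨IsFreeGroup.Generators (stageHom A t n).ker, ?_, ⟨IsFreeGroup.basis _⟩⟩
  by_contra hfin
  rw [not_infinite_iff_finite] at hfin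
  have hfg : Group.FG (stageHom A t n).ker :=
    Group.fg_of_surjective (f := (IsFreeGroup.mulEquiv (stageHom A t n).ker).toMonoidHom)
      (IsFreeGroup.mulEquiv (stageHom A t n).ker).surjective
  obtain ⟨m, hm⟩ := exists_stageHom_injective hA ht ((Group.fg_iff_subgroup_fg _).1 hfg)
  exact hinj m hm

/-- The edge group of the `n`-th stage, as a subgroup of the stage. -/
noncomputable def stageEdge (A : Subgroup G) (t : G) (n : ℕ) : Subgroup (Stage A t n) :=
  ((tower A t n).subgroupOf (tower A t (n + 1))).map (vertexHom A t n)

theorem isSplitting_stage {π : G →* Multiplicative ℤ} (hA : A ≤ π.ker) (n : ℕ) :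
    IsSplitting (π.comp (stageHom A t n)) (vertexHom A t n).range (stageEdge A t n)
      (stableLetter A t n) := by
  have hU : stageEdge A t n ≤ (vertexHom A t n).range := by
    rintro _ ⟨b, -, rfl⟩
    exact ⟨b, rfl⟩
  have hV : conjSubgroup (stableLetter A t n) (stageEdge A t n) ≤ (vertexHom A t n).range := by
    rintro _ ⟨_, ⟨b, hb, rfl⟩, rfl⟩
    exact ⟨⟨t * b * t⁻¹, conj_tower_le A t n ⟨b, hb, rfl⟩⟩, vertexHom_conj_inv hb rfl⟩
  refine ⟨?_, hU, hV, canonicalHom_range_bijective _ _ hU hV⟩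
  rintro _ ⟨b, rfl⟩
  rw [MonoidHom.mem_ker, MonoidHom.comp_apply, stageHom_vertexHom]
  exact tower_le_ker A t π hA _ b.2

/-- `G` is the direct limit of the stages. -/
theorem exists_directLimit_mulEquiv {π : G →* Multiplicative ℤ} (hA : A ≤ π.ker)
    (ht : π t = Multiplicative.ofAdd 1) (h : A ⊔ Subgroup.zpowers t = ⊤) :
    ∃ e : DirectLimit (Stage A t) (transition (A := A) (t := t)) ≃* G,
      ∀ (n : ℕ) (x : Stage A t n),
        e (⟦⟨n, x⟩⟧ : DirectLimit (Stage A t) (transition (A := A) (t := t))) =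
          stageHom A t n x := by
  let f : DirectLimit (Stage A t) (transition (A := A) (t := t)) →* G :=
    MonoidHom.mk' (DirectLimit.lift _ (fun i x => stageHom A t i x)
      (fun i j hij x => (stageHom_transition hij x).symm))
      (fun x y => DirectLimit.lift_mul (fun i => stageHom A t i) _ x y)
  have hf : ∀ n x, f ⟦⟨n, x⟩⟧ = stageHom A t n x := fun _ _ => rfl
  refine ⟨MulEquiv.ofBijective f ⟨(injective_iff_map_eq_one _).2 fun z hz => ?_, fun g => ?_⟩, hf⟩
  · induction z using DirectLimit.induction with
    | ih n x =>
      obtain ⟨m, hm, hx⟩ := exists_transition_eq_one hA ht (w := x) hz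
      exact (DirectLimit.exists_eq_one _).2 ⟨m, hm, hx⟩
  · obtain ⟨x, rfl⟩ := stageHom_surjective h 0 g
    exact ⟨⟦⟨0, x⟩⟧, rfl⟩

end Tower

/-! ### Choice of generators and the dichotomy -/

/-- A finitely generated group with a map to `ℤ` is generated by a finitely generated subgroup of
the kernel and an element that maps to a generator of `ℤ`. -/
theorem exists_fg_sup_zpowers_eq_top (hG : Group.FG G) {π : G →* Multiplicative ℤ} {t : G}
    (ht : π t = Multiplicative.ofAdd 1) :
    ∃ A : Subgroup G, A.FG ∧ A ≤ π.ker ∧ A ⊔ Subgroup.zpowers t = ⊤ := by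
  classical
  obtain ⟨S, hS⟩ := Group.fg_def.1 hG
  -- Each generator is pushed into the kernel by a power of `t`.
  let f : G → G := fun s => s * (t ^ (π s).toAdd)⁻¹
  refine ⟨Subgroup.closure (f '' S), ⟨S.image f, by simp⟩, ?_, ?_⟩
  · rw [Subgroup.closure_le]
    rintro _ ⟨s, -, rfl⟩
    simp only [f, SetLike.mem_coe, MonoidHom.mem_ker, map_mul, map_inv, map_zpow, ht]
    apply Multiplicative.toAdd.injective
    simp
  · rw [eq_top_iff, ← hS, Subgroup.closure_le]
    intro s hs
    have hfs : s = f s * t ^ (π s).toAdd := by simp [f]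
    rw [hfs]
    exact Subgroup.mul_mem_sup (Subgroup.subset_closure ⟨s, hs, rfl⟩)
      (Subgroup.zpow_mem_zpowers t _)

end HNNSplitting

theorem mainTheorem4 {G : Type u} [Group G] (hG : Group.FG G)
    (π : G →* Multiplicative ℤ) (hπ : Function.Surjective π) :
    (∃ U : Subgroup G, U.FG ∧ HNNSplitting.SplitsOver π U) ∨
    (∃ (Γ : ℕ → Type u) (_ : ∀ n, Group (Γ n))
        (φ : ∀ i j : ℕ, i ≤ j → Γ i →* Γ j)
        (_ : DirectedSystem Γ (fun i j h => φ i j h))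
        (lam : ∀ n, Γ n →* G)
        (e : DirectLimit Γ φ ≃* G),
      -- the groups are finitely generated, the maps are epimorphisms, the limit is `G`
      (∀ n, Group.FG (Γ n)) ∧
      (∀ n, Function.Surjective (φ n (n + 1) (Nat.le_succ n))) ∧
      (∀ (n : ℕ) (x : Γ n), e (⟦⟨n, x⟩⟧ : DirectLimit Γ φ) = lam n x) ∧
      -- the kernels of the limiting maps are free of infinite rank
      (∀ n, HNNSplitting.IsFreeOfInfiniteRank (lam n).ker) ∧
      -- the epimorphisms to `ℤ` split compatibly over finitely generated subgroups
      (∃ (B U : ∀ n, Subgroup (Γ n)) (t : ∀ n, Γ n),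
        (∀ n, (U n).FG) ∧
        (∀ n, HNNSplitting.IsSplitting (π.comp (lam n)) (B n) (U n) (t n)) ∧
        (∀ n, Set.InjOn (φ n (n + 1) (Nat.le_succ n)) (B n)) ∧
        (∀ n, (B n).map (φ n (n + 1) (Nat.le_succ n)) ≤ B (n + 1)) ∧
        (∀ n, (U n).map (φ n (n + 1) (Nat.le_succ n)) ≤ U (n + 1)) ∧
        (∀ n, φ n (n + 1) (Nat.le_succ n) (t n) = t (n + 1)))) := by

  obtain ⟨t, ht⟩ := hπ (Multiplicative.ofAdd 1)
  obtain ⟨A, hfg, hA, htop⟩ := HNNSplitting.exists_fg_sup_zpowers_eq_top hG ht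
  by_cases hinj : ∃ m, Function.Injective (HNNSplitting.stageHom A t m)
  · obtain ⟨m, hm⟩ := hinj
    exact Or.inl ⟨HNNSplitting.tower A t m, HNNSplitting.fg_tower A t hfg m,
      HNNSplitting.tower A t (m + 1), t, HNNSplitting.tower_le_ker A t π hA _,
      HNNSplitting.tower_le_succ A t m, HNNSplitting.conj_tower_le A t m,
      hm, HNNSplitting.stageHom_surjective htop m⟩
  · rw [not_exists] at hinj
    obtain ⟨e, he⟩ := HNNSplitting.exists_directLimit_mulEquiv hA ht htop
    refine Or.inr ⟨HNNSplitting.Stage A t, inferInstance, HNNSplitting.transition, inferInstance,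
      HNNSplitting.stageHom A t, e, HNNSplitting.fg_stage hfg,
      fun n => HNNSplitting.transition_surjective _, he,
      HNNSplitting.isFreeOfInfiniteRank_ker_stageHom hA ht hinj,
      fun n => (HNNSplitting.vertexHom A t n).range, HNNSplitting.stageEdge A t,
      HNNSplitting.stableLetter A t,
      fun n => HNNSplitting.fg_map (HNNSplitting.fg_subgroupOf (HNNSplitting.fg_tower A t hfg n)
        (HNNSplitting.tower_le_succ A t n)) _,
      HNNSplitting.isSplitting_stage hA, fun n => ?_, fun n => ?_, fun n => ?_,
      fun n => HNNSplitting.transition_stableLetter _⟩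
    · rintro _ ⟨b, rfl⟩ _ ⟨c, rfl⟩ h
      -- Injectivity on the vertex group can be tested in `G`, where both vertex groups embed by
      -- inclusion.
      have h' := congrArg (HNNSplitting.stageHom A t (n + 1)) h
      rw [HNNSplitting.stageHom_transition, HNNSplitting.stageHom_transition,
        HNNSplitting.stageHom_vertexHom, HNNSplitting.stageHom_vertexHom] at h'
      rw [Subtype.ext h']
    · rintro _ ⟨_, ⟨b, rfl⟩, rfl⟩
      exact ⟨_, (HNNSplitting.transition_vertexHom _ b).symm⟩
    · rintro _ ⟨_, ⟨b, hb, rfl⟩, rfl⟩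
      exact ⟨_, HNNSplitting.tower_le_succ A t n hb,
        (HNNSplitting.transition_vertexHom _ b).symm⟩
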